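/- Let $\mathcal A$ be the set of all arithmetical functions $f:\mathbb N=\{1,2,3,\dots\}\to\mathbb C$. For $f,g\in\mathcal A$ let $f+g$ be the pointwise sum, and let $f\circ g$ be the binomial convolution $$(f\circ g)(n)=\sum_{d\mid n}\left(\prod_p\binom{\nu_p(n)}{\nu_p(d)}\right)f(d)\,g(n/d)\qquad(n\in\mathbb N),$$ where the product is over all primes $p$ and $\nu_p(n)$ denotes the exponent of $p$ in the prime factorization of $n$. Then $(\mathcal A,+,\circ)$, which is a commutative ring whose identity is the function $\delta$ with $\delta(1)=1$ and $\delta(n)=0$ for $n>1$, is an integral domain. It is even a unique factorization domain. -/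

import Mathlib

/-- `∏_p C(ν_p(n), ν_p(d))`. The product runs over the primes dividing `n`; when `d ∣ n`
every other prime contributes `C(0, 0) = 1`. -/
def binomialWeight (n d : ℕ) : ℕ :=
  ∏ p ∈ n.primeFactors, (n.factorization p).choose (d.factorization p)

/-- The binomial convolution `(f ∘ g)(n) = ∑_{d ∣ n} (∏_p C(ν_p(n), ν_p(d))) f(d) g(n / d)`
of complex-valued arithmetical functions. (`ArithmeticFunction ℂ` is the set of functions
on the positive integers, extended by the value `0` at `0`.) -/
noncomputable def binomialConvolution (f g : ArithmeticFunction ℂ) : ArithmeticFunction ℂ :=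
  ⟨fun n => ∑ d ∈ n.divisors, (binomialWeight n d : ℂ) * f d * g (n / d), by simp⟩

/-- The set of arithmetical functions, to be given the ring structure `(+, ∘)`. It is a type
synonym, because the multiplication of `ArithmeticFunction ℂ` is the Dirichlet convolution. -/
def BinomialConvolutionRing : Type := ArithmeticFunction ℂ

namespace BinomialConvolutionRing

/-- Addition is pointwise addition of arithmetical functions. -/
noncomputable instance : AddCommGroup BinomialConvolutionRing :=
  inferInstanceAs (AddCommGroup (ArithmeticFunction ℂ))

/-- Multiplication is the binomial convolution. -/
noncomputable instance : Mul BinomialConvolutionRing := ⟨binomialConvolution⟩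

/-- The identity is `δ`, with `δ(1) = 1` and `δ(n) = 0` for `n > 1`. -/
noncomputable instance : One BinomialConvolutionRing := ⟨(1 : ArithmeticFunction ℂ)⟩

/-- `ξ(n) = ∏_p ν_p(n)!`, used below only to check the ring axioms. -/
def xi (n : ℕ) : ℕ := ∏ p ∈ n.primeFactors, (n.factorization p).factorial

theorem xi_ne_zero (n : ℕ) : (xi n : ℂ) ≠ 0 := by
  have h : xi n ≠ 0 := Finset.prod_ne_zero_iff.2 fun p _ => Nat.factorial_ne_zero _
  exact_mod_cast h

theorem xi_eq_of_dvd {d n : ℕ} (hn : n ≠ 0) (h : d ∣ n) :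
    xi d = ∏ p ∈ n.primeFactors, (d.factorization p).factorial := by
  refine Finset.prod_subset (Nat.primeFactors_mono h hn) fun p _ hp => ?_
  rw [← Nat.support_factorization, Finsupp.notMem_support_iff] at hp
  rw [hp, Nat.factorial_zero]

theorem binomialWeight_mul_xi {a b : ℕ} (h : a * b ≠ 0) :
    binomialWeight (a * b) a * xi a * xi b = xi (a * b) := by
  rw [xi_eq_of_dvd h (dvd_mul_right a b), xi_eq_of_dvd h (dvd_mul_left b a), binomialWeight, xi,
    ← Finset.prod_mul_distrib, ← Finset.prod_mul_distrib]
  refine Finset.prod_congr rfl fun p _ => ?_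
  rw [Nat.factorization_mul (left_ne_zero_of_mul h) (right_ne_zero_of_mul h), Finsupp.add_apply]
  simpa using Nat.choose_mul_factorial_mul_factorial
    (Nat.le_add_right (a.factorization p) (b.factorization p))

/-- The map `f ↦ f / ξ`. -/
noncomputable def divXi (f : BinomialConvolutionRing) : ArithmeticFunction ℂ :=
  ⟨fun n => (show ArithmeticFunction ℂ from f) n / (xi n : ℂ),
    (congrArg (· / (xi 0 : ℂ)) (ArithmeticFunction.map_zero (f := f))).trans (zero_div _)⟩

theorem divXi_injective : Function.Injective divXi := by
  intro f g h
  refine ArithmeticFunction.ext fun n => ?_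
  have hn := DFunLike.congr_fun h n
  exact (div_left_inj' (xi_ne_zero n)).1 hn

theorem divXi_add (f g : BinomialConvolutionRing) : divXi (f + g) = divXi f + divXi g :=
  ArithmeticFunction.ext fun _ => add_div _ _ _

theorem divXi_zero : divXi 0 = 0 :=
  ArithmeticFunction.ext fun _ => zero_div _

theorem divXi_one : divXi 1 = 1 := by
  refine ArithmeticFunction.ext fun n => ?_
  change (1 : ArithmeticFunction ℂ) n / (xi n : ℂ) = _
  by_cases h : n = 1
  · subst h
    simp [xi]
  · simp [ArithmeticFunction.one_apply_ne h]

theorem divXi_mul (f g : BinomialConvolutionRing) : divXi (f * g) = divXi f * divXi g := by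
  refine ArithmeticFunction.ext fun n => ?_
  rw [ArithmeticFunction.mul_apply]
  change (∑ d ∈ n.divisors, (binomialWeight n d : ℂ) * (show ArithmeticFunction ℂ from f) d *
    (show ArithmeticFunction ℂ from g) (n / d)) / (xi n : ℂ) = _
  rw [← Nat.sum_divisorsAntidiagonal fun a b => (binomialWeight n a : ℂ) *
    (show ArithmeticFunction ℂ from f) a * (show ArithmeticFunction ℂ from g) b,
    Finset.sum_div]
  refine Finset.sum_congr rfl fun x hx => ?_
  obtain ⟨rfl, h0⟩ := Nat.mem_divisorsAntidiagonal.1 hx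
  have h : (binomialWeight (x.1 * x.2) x.1 : ℂ) * xi x.1 * xi x.2 = xi (x.1 * x.2) := by
    exact_mod_cast binomialWeight_mul_xi h0
  change _ = (show ArithmeticFunction ℂ from f) x.1 / (xi x.1 : ℂ) *
    ((show ArithmeticFunction ℂ from g) x.2 / (xi x.2 : ℂ))
  have h1 := xi_ne_zero x.1
  have h2 := xi_ne_zero x.2
  have h3 := xi_ne_zero (x.1 * x.2)
  rw [div_mul_div_comm, div_eq_div_iff h3 (mul_ne_zero h1 h2), ← h]
  ring

/-- The commutative ring `(A, +, ∘)`. -/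
noncomputable instance : CommRing BinomialConvolutionRing where
  __ := (inferInstance : AddCommGroup BinomialConvolutionRing)
  mul := (· * ·)
  one := 1
  left_distrib f g h := divXi_injective (by simp only [divXi_mul, divXi_add, mul_add])
  right_distrib f g h := divXi_injective (by simp only [divXi_mul, divXi_add, add_mul])
  zero_mul f := divXi_injective (by simp only [divXi_mul, divXi_zero, zero_mul])
  mul_zero f := divXi_injective (by simp only [divXi_mul, divXi_zero, mul_zero])
  mul_assoc f g h := divXi_injective (by simp only [divXi_mul, mul_assoc])
  one_mul f := divXi_injective (by simp only [divXi_mul, divXi_one, one_mul])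
  mul_one f := divXi_injective (by simp only [divXi_mul, divXi_one, mul_one])
  mul_comm f g := divXi_injective (by simp only [divXi_mul, mul_comm])

end BinomialConvolutionRing

/-! Division by `xi` turns binomial convolution into Dirichlet convolution, and reading `n` through
its exponent vector turns that into multiplication of complex power series with one variable per
prime. So the ring is a power series ring over `ℂ` in countably many variables.

In finitely many variables, induct on their number: after a linear change of variables a nonzero
element of a prime ideal becomes regular in one variable, Weierstrass preparation replaces it by a
polynomial, and a prime factor of that polynomial stays prime as a power series. Hence every nonzero
prime ideal contains a prime element.

The countable case is an inverse limit along surjective local maps. Such maps never decrease the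
number of prime factors, so for the images of a fixed `f` this number is eventually constant. From
there on prime divisors lift from level to level, and a compatible sequence of them glues to a prime
divisor of `f`. Cancelling it lowers the count. -/

/-- A compatible sequence of elements of the rings `A N, A (N + 1), …`, obtained by lifting a
property step by step along the transition maps. -/
theorem exists_compatible_sequence {A : ℕ → Type*} (φ : ∀ n, A (n + 1) → A n)
    (P : ∀ n, A n → Prop) (N : ℕ) {a : A N} (ha : P N a)
    (step : ∀ n, N ≤ n → ∀ x, P n x → ∃ y, P (n + 1) y ∧ φ n y = x) :
    ∃ s : ∀ k, A (N + k), (∀ k, P (N + k) (s k)) ∧ ∀ k, φ (N + k) (s (k + 1)) = s k := by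
  choose g hg using step
  let t : ∀ k, {x : A (N + k) // P (N + k) x} :=
    Nat.rec ⟨a, ha⟩ fun k x => ⟨g (N + k) (Nat.le_add_right _ _) x.1 x.2, (hg _ _ _ x.2).1⟩
  exact ⟨fun k => (t k).1, fun k => (t k).2, fun k => (hg _ _ _ (t k).2).2⟩

/-! ### Divisibility and primality in an inverse limit -/

section InverseLimit

variable {R : Type*} [CommRing R] {A : ℕ → Type*} [∀ n, CommRing (A n)] (φ : ∀ n, A (n + 1) →+* A n) (π : ∀ n, R →+* A n)

theorem map_eq_zero_of_le (hφπ : ∀ n x, φ n (π (n + 1) x) = π n x) {m n : ℕ} (h : m ≤ n) {x : R}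
    (hx : π n x = 0) : π m x = 0 := by
  induction n, h using Nat.le_induction with
  | base => exact hx
  | succ n _ ih => exact ih (by rw [← hφπ, hx, map_zero])

theorem map_dvd_of_le (hφπ : ∀ n x, φ n (π (n + 1) x) = π n x) {m n : ℕ} (h : m ≤ n) {x y : R}
    (hx : π n x ∣ π n y) : π m x ∣ π m y := by
  induction n, h using Nat.le_induction with
  | base => exact hx
  | succ n _ ih => exact ih (by rw [← hφπ, ← hφπ n y]; exact map_dvd _ hx)

theorem dvd_of_forall_map_dvd [∀ n, IsDomain (A n)]
    (hφπ : ∀ n x, φ n (π (n + 1) x) = π n x)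
    (hinj : ∀ N x, (∀ k, π (N + k) x = 0) → x = 0)
    (hglue : ∀ N (a : ∀ k, A (N + k)), (∀ k, φ (N + k) (a (k + 1)) = a k) →
      ∃ x, ∀ k, π (N + k) x = a k)
    {N : ℕ} {p a : R} (hp : ∀ k, π (N + k) p ≠ 0) (h : ∀ k, π (N + k) p ∣ π (N + k) a) :
    p ∣ a := by
  choose q hq using h
  obtain ⟨x, hx⟩ := hglue N q fun k => by
    -- Quotients by a nonzero element of a domain are unique, so those at successive levels are
    -- compatible.
    apply mul_left_cancel₀ (hp k)
    rw [← hq, ← hφπ (N + k) a, ← hφπ (N + k) p]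
    exact (map_mul _ _ _).symm.trans (congrArg _ (hq (k + 1)).symm)
  refine ⟨x, sub_eq_zero.1 (hinj N _ fun k => ?_)⟩
  rw [map_sub, map_mul, hx, ← hq, sub_self]

/-- An element of an inverse limit is prime if all its late enough components are prime. -/
theorem prime_of_forall_map_prime [∀ n, IsDomain (A n)]
    (hφπ : ∀ n x, φ n (π (n + 1) x) = π n x)
    (hinj : ∀ N x, (∀ k, π (N + k) x = 0) → x = 0)
    (hglue : ∀ N (a : ∀ k, A (N + k)), (∀ k, φ (N + k) (a (k + 1)) = a k) →
      ∃ x, ∀ k, π (N + k) x = a k)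
    {N : ℕ} {p : R} (hp : ∀ k, Prime (π (N + k) p)) : Prime p := by
  refine ⟨fun h => (hp 0).ne_zero (by rw [h, map_zero]), fun h => (hp 0).not_isUnit (h.map _),
    fun a b hab => ?_⟩
  by_contra! hcon
  have key : ∀ c, ¬ p ∣ c → ∃ k, ¬ π (N + k) p ∣ π (N + k) c := fun c hc => by
    by_contra! hall
    exact hc (dvd_of_forall_map_dvd φ π hφπ hinj hglue (fun k => (hp k).ne_zero) hall)
  obtain ⟨i, hi⟩ := key a hcon.1
  obtain ⟨j, hj⟩ := key b hcon.2
  -- Divisibility passes to lower levels, so both failures persist at the common level `N + (i +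
  -- j)`.
  have h := map_dvd (π (N + (i + j))) hab
  rw [map_mul] at h
  rcases (hp _).dvd_or_dvd h with h | h
  · exact hi (map_dvd_of_le φ π hφπ (by omega) h)
  · exact hj (map_dvd_of_le φ π hφπ (by omega) h)

end InverseLimit

/-! ### Counting prime factors along local homomorphisms -/

section Factors

open UniqueFactorizationMonoid

variable {A B : Type*} [CommRing A] [CommRing B] [UniqueFactorizationMonoid A]

theorem card_factors_mul {x y : A} (hx : x ≠ 0) (hy : y ≠ 0) :
    (factors (x * y)).card = (factors x).card + (factors y).card := by
  rw [Multiset.card_eq_card_of_rel (factors_mul hx hy), Multiset.card_add]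

theorem card_factors_eq_zero_iff {x : A} (hx : x ≠ 0) : (factors x).card = 0 ↔ IsUnit x := by
  rw [Multiset.card_eq_zero, factors_eq_zero hx]

theorem card_factors_eq_one_iff [IsDomain A] {x : A} (hx : x ≠ 0) : (factors x).card = 1 ↔ Prime x := by
  constructor
  · intro h
    obtain ⟨b, hb⟩ := Multiset.card_eq_one.1 h
    have hx' := factors_prod hx
    rw [hb, Multiset.prod_singleton] at hx'
    exact hx'.prime (prime_of_factor b (by rw [hb]; exact Multiset.mem_singleton_self b))
  · intro h
    obtain ⟨b, -, hb⟩ := factors_eq_singleton_of_irreducible h.irreducible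
    rw [hb, Multiset.card_singleton]

variable [IsDomain A] [IsDomain B] [UniqueFactorizationMonoid B] (φ : A →+* B) [IsLocalHom φ]

/-- A local homomorphism does not decrease the number of prime factors. -/
theorem card_factors_le_card_factors_map {x : A} (hx : φ x ≠ 0) :
    (factors x).card ≤ (factors (φ x)).card := by
  induction x using UniqueFactorizationMonoid.induction_on_prime with
  | h₁ => exact absurd (map_zero φ) hx
  | h₂ x h => rw [factors_of_isUnit h]; exact Nat.zero_le _
  | h₃ a p ha hp ih =>
    have hpa : φ p ≠ 0 ∧ φ a ≠ 0 := by rwa [map_mul, mul_ne_zero_iff] at hx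
    have h1 := (card_factors_eq_one_iff hp.ne_zero).2 hp
    have h2 : (factors (φ p)).card ≠ 0 := fun h =>
      hp.not_isUnit (isUnit_of_map_unit φ p ((card_factors_eq_zero_iff hpa.1).1 h))
    have := ih hpa.2
    rw [map_mul, card_factors_mul hp.ne_zero ha, card_factors_mul hpa.1 hpa.2]
    omega

/-- If a surjective local homomorphism preserves the number of prime factors of `x`, then it
is possible to lift the prime divisors of the image of `x`. -/
theorem exists_prime_dvd_map_eq (hφ : Function.Surjective φ) {x : A} (hx : φ x ≠ 0)
    (hcard : (factors (φ x)).card = (factors x).card) {p : B} (hp : Prime p) (hpx : p ∣ φ x) :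
    ∃ q, (Prime q ∧ q ∣ x) ∧ φ q = p := by
  induction x using UniqueFactorizationMonoid.induction_on_prime with
  | h₁ => exact absurd (map_zero φ) hx
  | h₂ x h => exact absurd (isUnit_of_dvd_unit hpx (h.map φ)) hp.not_isUnit
  | h₃ a r ha hr ih =>
    have hra : φ r ≠ 0 ∧ φ a ≠ 0 := by rwa [map_mul, mul_ne_zero_iff] at hx
    have h1 := (card_factors_eq_one_iff hr.ne_zero).2 hr
    have h2 := card_factors_le_card_factors_map φ hra.1
    have h3 := card_factors_le_card_factors_map φ hra.2
    rw [map_mul, card_factors_mul hr.ne_zero ha, card_factors_mul hra.1 hra.2] at hcard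
    rw [map_mul] at hpx
    rcases hp.dvd_or_dvd hpx with h | h
    -- Neither count can drop under `φ` and their sum is preserved, so `φ r` has exactly one prime
    -- factor.
    · have hr' : Prime (φ r) := (card_factors_eq_one_iff hra.1).1 (by omega)
      obtain ⟨u, hu⟩ := ((hp.dvd_prime_iff_associated hr').1 h).symm
      -- The unit relating `φ r` to `p` lifts to a unit, which corrects `r` to an associate with
      -- image exactly `p`.
      obtain ⟨v, hv⟩ := hφ u
      have hvu : IsUnit v := isUnit_of_map_unit φ v (hv ▸ u.isUnit)
      have hassoc : Associated (r * v) r := associated_mul_unit_left r v hvu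
      exact ⟨r * v, ⟨hassoc.symm.prime hr, hassoc.dvd.trans (dvd_mul_right r a)⟩, by
        rw [map_mul, hv, hu]⟩
    · obtain ⟨q, ⟨hq, hqa⟩, hqp⟩ := ih hra.2 (by omega) h
      exact ⟨q, ⟨hq, hqa.mul_left r⟩, hqp⟩

end Factors

/-- An inverse limit of a sequence of unique factorization domains along surjective local
homomorphisms is a unique factorization domain. -/
theorem uniqueFactorizationMonoid_of_inverseLimit {R : Type*} [CommRing R] [IsDomain R]
    {A : ℕ → Type*} [∀ n, CommRing (A n)] [∀ n, IsDomain (A n)]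
    [∀ n, UniqueFactorizationMonoid (A n)] (φ : ∀ n, A (n + 1) →+* A n) (π : ∀ n, R →+* A n)
    [∀ n, IsLocalHom (φ n)] [∀ n, IsLocalHom (π n)] (hφ : ∀ n, Function.Surjective (φ n))
    (hφπ : ∀ n x, φ n (π (n + 1) x) = π n x)
    (hinj : ∀ N x, (∀ k, π (N + k) x = 0) → x = 0)
    (hglue : ∀ N (a : ∀ k, A (N + k)), (∀ k, φ (N + k) (a (k + 1)) = a k) →
      ∃ x, ∀ k, π (N + k) x = a k) :
    UniqueFactorizationMonoid R := by
  refine UniqueFactorizationMonoid.of_exists_prime_factors fun f hf => ?_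
  let c : R → ℕ → ℕ := fun f n => (UniqueFactorizationMonoid.factors (π n f)).card
  suffices H : ∀ k f n, π n f ≠ 0 → c f n = k →
      ∃ s : Multiset R, (∀ b ∈ s, Prime b) ∧ Associated s.prod f by
    obtain ⟨n, hn⟩ : ∃ n, π (0 + n) f ≠ 0 := by
      by_contra! h
      exact hf (hinj 0 f h)
    exact H _ f _ hn rfl
  intro k
  induction k using Nat.strong_induction_on with
  | _ k ih =>
    intro f n hn hk
    have hne : ∀ m, n ≤ m → π m f ≠ 0 := fun m hm h => hn (map_eq_zero_of_le φ π hφπ hm h)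
    have hstep : ∀ m, n ≤ m → c f (m + 1) ≤ c f m := fun m hm => by
      have := card_factors_le_card_factors_map (φ m) (x := π (m + 1) f) (by
        rw [hφπ]; exact hne m hm)
      rwa [hφπ] at this
    have hanti : ∀ m l, n ≤ m → m ≤ l → c f l ≤ c f m := fun m l hm hl => by
      induction l, hl using Nat.le_induction with
      | base => exact le_rfl
      | succ l hl ih => exact (hstep l (hm.trans hl)).trans ih
    -- A nonincreasing sequence of naturals is constant from its minimum on.
    obtain ⟨N, hN, hmin⟩ : ∃ N, n ≤ N ∧ ∀ m, N ≤ m → c f m = c f N := by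
      obtain ⟨N, hN, hmin⟩ := exists_minimalFor_of_wellFoundedLT (n ≤ ·) (c f) ⟨n, le_rfl⟩
      refine ⟨N, hN, fun m hm => ?_⟩
      have h1 := hanti N m hN hm
      exact le_antisymm h1 (hmin (hN.trans hm) h1)
    by_cases hunit : IsUnit (π N f)
    · exact ⟨0, by simp, by
        simpa using (associated_one_iff_isUnit.2 (isUnit_of_map_unit (π N) f hunit)).symm⟩
    obtain ⟨p₀, hp₀, hp₀f⟩ := WfDvdMonoid.exists_irreducible_factor hunit (hne N hN)
    obtain ⟨s, hs, hs'⟩ := exists_compatible_sequence (fun n => φ n)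
      (fun n x => Prime x ∧ x ∣ π n f) N ⟨hp₀.prime, hp₀f⟩ (fun m hm x hx => by
        refine exists_prime_dvd_map_eq (φ m) (hφ m) (by rw [hφπ]; exact hne m (hN.trans hm))
          ?_ hx.1 (by rw [hφπ]; exact hx.2)
        rw [hφπ]
        exact (hmin m hm).trans (hmin (m + 1) (by omega)).symm)
    obtain ⟨p, hp⟩ := hglue N s hs'
    have hprime : Prime p :=
      prime_of_forall_map_prime φ π hφπ hinj hglue (N := N) fun k => by rw [hp]; exact (hs k).1
    obtain ⟨g, rfl⟩ : p ∣ f :=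
      dvd_of_forall_map_dvd φ π hφπ hinj hglue (N := N)
        (fun k => by rw [hp]; exact (hs k).1.ne_zero) fun k => by rw [hp]; exact (hs k).2
    have hpN : Prime (π N p) := by
      have h : Prime (π (N + 0) p) := by rw [hp]; exact (hs 0).1
      exact h
    have hgN : π N g ≠ 0 := fun h => hne N hN (by rw [map_mul, h, mul_zero])
    have hcard : c (p * g) N = 1 + c g N := by
      change (UniqueFactorizationMonoid.factors (π N (p * g))).card = _
      rw [map_mul, card_factors_mul hpN.ne_zero hgN,
        (card_factors_eq_one_iff hpN.ne_zero).2 hpN]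
    have := hanti n N le_rfl hN
    obtain ⟨t, ht, htg⟩ := ih (c g N) (by omega) g N hgN rfl
    refine ⟨p ::ₘ t, fun b hb => ?_, ?_⟩
    · rcases Multiset.mem_cons.1 hb with rfl | hb
      · exact hprime
      · exact ht b hb
    · rw [Multiset.prod_cons]
      exact htg.mul_left p

/-! ### Completeness of power series rings in finitely many variables -/

open MvPowerSeries in
theorem MvPowerSeries.maximalIdeal_eq_span_X {σ k : Type*} [Finite σ] [Field k] :
    IsLocalRing.maximalIdeal (MvPowerSeries σ k) = Ideal.span (Set.range X) := by
  classical
  have := Fintype.ofFinite σ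
  apply le_antisymm
  · have key : ∀ s : Finset σ, ∀ f : MvPowerSeries σ k,
        (∀ d : σ →₀ ℕ, (∀ i ∈ s, d i = 0) → coeff d f = 0) → f ∈ Ideal.span (Set.range X) := by
      intro s
      induction s using Finset.induction_on with
      | empty =>
        intro f hf
        have : f = 0 := MvPowerSeries.ext fun d => hf d (by simp)
        rw [this]
        exact zero_mem _
      | insert a s has ih =>
        intro f hf
        -- The terms of `f` divisible by `X a`; the rest is handled by the remaining variables.
        let g : MvPowerSeries σ k := fun d => if d a = 0 then 0 else coeff d f
        have hg : ∀ d, coeff d g = if d a = 0 then 0 else coeff d f := fun d => rfl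
        rw [← add_sub_cancel g f]
        refine add_mem ?_ (ih _ fun d hd => ?_)
        · obtain ⟨q, hq⟩ : X a ∣ g := X_dvd_iff.2 fun m hm => by rw [hg, if_pos hm]
          rw [hq]
          exact Ideal.mul_mem_right _ _ (Ideal.subset_span (Set.mem_range_self a))
        · rw [map_sub, hg]
          split_ifs with h
          · rw [sub_zero]
            exact hf d (by simpa [h] using hd)
          · exact sub_self _
    intro f hf
    refine key Finset.univ f fun d hd => ?_
    obtain rfl : d = 0 := Finsupp.ext fun i => hd i (Finset.mem_univ i)
    rw [IsLocalRing.mem_maximalIdeal, mem_nonunits_iff, isUnit_iff_constantCoeff,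
      isUnit_iff_ne_zero, not_not] at hf
    simpa using hf
  · rw [Ideal.span_le]
    rintro _ ⟨i, rfl⟩
    rw [SetLike.mem_coe, IsLocalRing.mem_maximalIdeal, mem_nonunits_iff, isUnit_iff_constantCoeff]
    simp

instance {σ k : Type*} [Finite σ] [Field k] :
    IsAdicComplete (IsLocalRing.maximalIdeal (MvPowerSeries σ k)) (MvPowerSeries σ k) := by
  rw [MvPowerSeries.maximalIdeal_eq_span_X]
  infer_instance

/-! ### Weierstrass preparation and prime elements -/

section Weierstrass
open Polynomial IsLocalRing

variable {A : Type*} [CommRing A] [IsDomain A] [IsLocalRing A]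

/-- A divisor of a distinguished polynomial is, up to a unit, distinguished. -/
theorem Polynomial.IsDistinguishedAt.exists_associated_of_dvd {p q : A[X]}
    (hp : p.IsDistinguishedAt (maximalIdeal A)) (hq : q ∣ p) :
    ∃ q' : A[X], Associated q' q ∧ q'.IsDistinguishedAt (maximalIdeal A) := by
  obtain ⟨r, rfl⟩ := hq
  have hu : IsUnit q.leadingCoeff :=
    .of_mul_eq_one r.leadingCoeff (by rw [← leadingCoeff_mul]; exact hp.monic)
  obtain ⟨u, hu⟩ := hu
  have hmonic : (C (↑u⁻¹ : A) * q).Monic := by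
    rw [Monic, leadingCoeff_mul, leadingCoeff_C, ← hu, Units.inv_mul]
  have hass : Associated (C (↑u⁻¹ : A) * q) q :=
    associated_unit_mul_left q _ (isUnit_C.2 u⁻¹.isUnit)
  refine ⟨_, hass, ⟨⟨fun {i} hi => ?_⟩, hmonic⟩⟩
  generalize C (↑u⁻¹ : A) * q = q' at *
  -- Over the residue field, a monic divisor of a power of `X` is itself a power of `X`.
  have hdvd : q'.map (residue A) ∣ X ^ (q * r).natDegree := by
    have h : (q * r).map (residue A) = X ^ (q * r).natDegree := hp.map_eq_X_pow
    rw [← h]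
    exact Polynomial.map_dvd _ (hass.dvd.trans (dvd_mul_right q r))
  obtain ⟨j, -, hj⟩ := (dvd_prime_pow prime_X _).1 hdvd
  have hj' : q'.map (residue A) = X ^ j :=
    eq_of_monic_of_associated (hmonic.map _) (monic_X_pow j) hj
  have hdeg : q'.natDegree = j := by
    rw [← hmonic.natDegree_map (residue A), hj', natDegree_X_pow]
  rw [← residue_eq_zero_iff, ← coeff_map, hj', coeff_X_pow, if_neg (by omega)]

/-- A prime ideal of `A⟦X⟧`, where `A` is a complete local unique factorization domain, contains
a prime element if it contains a power series which is regular in `X`. -/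
theorem PowerSeries.exists_prime_mem_of_map_residue_ne_zero [UniqueFactorizationMonoid A]
    [IsAdicComplete (maximalIdeal A) A] (P : Ideal (PowerSeries A)) [P.IsPrime]
    {f : PowerSeries A} (hfP : f ∈ P) (hf : f.map (residue A) ≠ 0) : ∃ p ∈ P, Prime p := by
  have hdist := f.isDistinguishedAt_weierstrassDistinguished hf
  have hunit := f.isUnit_weierstrassUnit hf
  have heq := f.eq_weierstrassDistinguished_mul_weierstrassUnit hf
  generalize f.weierstrassDistinguished hf = g at *
  generalize f.weierstrassUnit hf = h at *
  have hgP : g ∈ P.comap (Polynomial.coeToPowerSeries.ringHom (R := A)) := by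
    rw [Ideal.mem_comap, Polynomial.coeToPowerSeries.ringHom_apply]
    rw [heq] at hfP
    exact (Ideal.mul_unit_mem_iff_mem P hunit).1 hfP
  obtain ⟨q, hq, hqg, hqP⟩ : ∃ q : A[X], Prime q ∧ q ∣ g ∧
      q ∈ P.comap (Polynomial.coeToPowerSeries.ringHom (R := A)) := by
    have hprod := UniqueFactorizationMonoid.factors_prod hdist.monic.ne_zero
    have hmem := (Ideal.mem_iff_of_associated hprod.symm).1 hgP
    obtain ⟨q, hq, hqP⟩ := (Ideal.IsPrime.multiset_prod_mem_iff_exists_mem inferInstance _).1 hmem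
    exact ⟨q, UniqueFactorizationMonoid.prime_of_factor q hq,
      (Multiset.dvd_prod hq).trans hprod.dvd, hqP⟩
  obtain ⟨q', hass, hdist'⟩ := hdist.exists_associated_of_dvd hqg
  have hq'P := (Ideal.mem_iff_of_associated hass).2 hqP
  rw [Ideal.mem_comap, Polynomial.coeToPowerSeries.ringHom_apply] at hq'P
  refine ⟨q', hq'P, ?_⟩
  have hprime : Prime q' := hass.symm.prime hq
  -- For distinguished `q'`, Weierstrass division identifies the quotients of `A[X]` and `A⟦X⟧` by
  -- `q'`, so primality transfers.
  have hdom : IsDomain (A[X] ⧸ Ideal.span {q'}) := (Ideal.Quotient.isDomain_iff_prime _).2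
    ((Ideal.span_singleton_prime hprime.ne_zero).2 hprime)
  have hdom' := hdist'.algEquivQuotient.symm.toMulEquiv.isDomain (A[X] ⧸ Ideal.span {q'})
  rw [Ideal.Quotient.isDomain_iff_prime] at hdom'
  exact (Ideal.span_singleton_prime (by
    rw [Ne, Polynomial.coe_eq_zero_iff]; exact hprime.ne_zero)).1 hdom'

end Weierstrass

/-! ### Changes of variables and the case of finitely many variables -/

namespace MvPowerSeries

section Subst

variable {σ R : Type*} [CommRing R]

/-- Two families of power series which are inverse to each other under substitution give an
automorphism of the ring of power series. -/
noncomputable def substEquiv {a b : σ → MvPowerSeries σ R} (ha : HasSubst a) (hb : HasSubst b)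
    (hab : ∀ i, subst b (a i) = X i) (hba : ∀ i, subst a (b i) = X i) :
    MvPowerSeries σ R ≃+* MvPowerSeries σ R :=
  RingEquiv.ofRingHom (substAlgHom (R := R) ha).toRingHom (substAlgHom (R := R) hb).toRingHom
    (RingHom.ext fun f => by
      change substAlgHom ha (substAlgHom hb f) = f
      rw [substAlgHom_apply, substAlgHom_apply, subst_comp_subst_apply hb ha, funext hba]
      exact congrFun subst_self f)
    (RingHom.ext fun f => by
      change substAlgHom hb (substAlgHom ha f) = f
      rw [substAlgHom_apply, substAlgHom_apply, subst_comp_subst_apply ha hb, funext hab]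
      exact congrFun subst_self f)

theorem substEquiv_apply {a b : σ → MvPowerSeries σ R} (ha : HasSubst a) (hb : HasSubst b)
    (hab : ∀ i, subst b (a i) = X i) (hba : ∀ i, subst a (b i) = X i) (f : MvPowerSeries σ R) :
    substEquiv ha hb hab hba f = subst a f :=
  substAlgHom_apply ha f

end Subst

variable {k : Type*} [Field k] {n : ℕ}

/-- The linear change of variables `X 0 ↦ c 0 * X 0`, `X i ↦ X i + c i * X 0` for `i ≠ 0`. -/
noncomputable def shear (c : Fin (n + 1) → k) (i : Fin (n + 1)) : MvPowerSeries (Fin (n + 1)) k :=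
  (if i = 0 then 0 else X i) + c i • X 0

theorem hasSubst_shear (c : Fin (n + 1) → k) : HasSubst (shear c) :=
  hasSubst_of_constantCoeff_zero fun i => by
    unfold shear
    split_ifs <;> simp [smul_eq_C_mul]

theorem subst_shear_shear {c d : Fin (n + 1) → k} (h0 : d 0 * c 0 = 1)
    (h : ∀ i, i ≠ 0 → d i + c i * d 0 = 0) (i : Fin (n + 1)) :
    subst (shear d) (shear c i) = X i := by
  have hX : ∀ j, subst (shear d) (X j : MvPowerSeries (Fin (n + 1)) k) = shear d j :=
    subst_X (hasSubst_shear d)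
  have hd0 : shear d 0 = d 0 • X 0 := by simp [shear]
  by_cases hi : i = 0
  · subst hi
    have : shear c 0 = c 0 • X 0 := by simp [shear]
    rw [this, subst_smul (hasSubst_shear d), hX, hd0, smul_smul, mul_comm, h0, one_smul]
  · have : shear c i = X i + c i • X 0 := by simp [shear, hi]
    rw [this, subst_add (hasSubst_shear d), subst_smul (hasSubst_shear d), hX, hX, hd0]
    have : shear d i = X i + d i • X 0 := by simp [shear, hi]
    rw [this, add_assoc, smul_smul, ← add_smul, h i hi, zero_smul, add_zero]

/-- Killing every variable but `X 0` sends `shear c i` to `c i` times that variable. -/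
theorem coeff_single_zero_prod_shear (c : Fin (n + 1) → k) (d : Fin (n + 1) →₀ ℕ) (m : ℕ) :
    coeff (Finsupp.single 0 m) (d.prod fun i e => shear c i ^ e) =
      if d.degree = m then d.prod fun i e => c i ^ e else 0 := by
  classical
  let e : Unit ↪ Fin (n + 1) := ⟨fun _ => 0, fun _ _ _ => rfl⟩
  have hs : Finsupp.single 0 m = Finsupp.embDomain e (Finsupp.single () m) := by
    rw [Finsupp.embDomain_single]
    rfl
  have hkill : ∀ i, killCompl e (shear c i) = c i • X () := fun i => by
    have h0 : killCompl (R := k) e (X 0) = X () := killCompl_X (e := e) ()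
    unfold shear
    rw [map_add, map_smul, h0]
    split_ifs with hi
    · rw [map_zero, zero_add]
    · rw [killCompl_X_eq_zero, zero_add]
      rintro ⟨_, h⟩
      exact hi h.symm
  rw [hs, ← coeff_killCompl, Finsupp.prod, map_prod]
  have : ∀ i ∈ d.support, killCompl e (shear c i ^ d i) = C (c i ^ d i) * X () ^ d i :=
    fun i _ => by rw [map_pow, hkill, smul_eq_C_mul, mul_pow, ← map_pow]
  rw [Finset.prod_congr rfl this, Finset.prod_mul_distrib, ← map_prod, coeff_C_mul,
    Finset.prod_pow_eq_pow_sum, coeff_X_pow]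
  have hd : ∑ i ∈ d.support, d i = d.degree := rfl
  rw [hd]
  simp only [(Finsupp.single_injective ()).eq_iff, mul_ite, mul_one, mul_zero, eq_comm (a := m),
    Finsupp.prod]

/-- The coefficient of `X 0 ^ m` after the shear is the value at `c` of the homogeneous part of
degree `m`, and a nonzero polynomial over an infinite field has a nonzero value. -/
theorem exists_coeff_subst_shear_ne_zero [Infinite k] {f : MvPowerSeries (Fin (n + 1)) k} (hf : f ≠ 0) :
    ∃ (c : Fin (n + 1) → k) (m : ℕ), c 0 ≠ 0 ∧
      coeff (Finsupp.single 0 m) (subst (shear c) f) ≠ 0 := by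
  classical
  obtain ⟨d₀, hd₀⟩ : ∃ d, coeff d f ≠ 0 := by
    by_contra! h
    exact hf (MvPowerSeries.ext h)
  set m := d₀.degree with hm
  let p : MvPolynomial (Fin (n + 1)) k := truncTotal (m + 1) (homogeneousComponent m f)
  have hp : ∀ d, p.coeff d = if d.degree = m then coeff d f else 0 := fun d => by
    rw [coeff_truncTotal_eq_ite, coeff_homogeneousComponent]
    split_ifs <;> first | rfl | omega
  -- The extra factor `X 0` forces `c 0 ≠ 0`, which makes the shear invertible.
  have hp0 : MvPolynomial.X 0 * p ≠ 0 := mul_ne_zero (MvPolynomial.X_ne_zero 0) fun h => by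
    have := hp d₀
    rw [h, MvPolynomial.coeff_zero, if_pos hm.symm] at this
    exact hd₀ this.symm
  obtain ⟨c, hc⟩ : ∃ c, MvPolynomial.eval c (MvPolynomial.X 0 * p) ≠ 0 := by
    by_contra! h
    exact hp0 (MvPolynomial.funext fun c => by rw [h, map_zero])
  rw [map_mul, MvPolynomial.eval_X] at hc
  refine ⟨c, m, left_ne_zero_of_mul hc, fun h => right_ne_zero_of_mul hc ?_⟩
  rw [← h, coeff_subst (hasSubst_shear c), MvPolynomial.eval_eq]
  simp_rw [coeff_single_zero_prod_shear, smul_eq_mul, mul_ite, mul_zero]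
  rw [finsum_eq_sum_of_support_subset (s := p.support)]
  · refine Finset.sum_congr rfl fun d _ => ?_
    rw [hp, ite_mul, zero_mul]
    rfl
  · intro d hd
    rw [Finset.mem_coe, MvPolynomial.mem_support_iff, hp]
    rw [Function.mem_support] at hd
    split_ifs at hd ⊢ with h
    · exact left_ne_zero_of_mul hd
    · exact absurd rfl hd

theorem exists_ringEquiv_map_residue_ne_zero [Infinite k] {f : MvPowerSeries (Fin (n + 1)) k}
    (hf : f ≠ 0) :
    ∃ e : MvPowerSeries (Fin (n + 1)) k ≃+* PowerSeries (MvPowerSeries (Fin n) k),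
      (e f).map (IsLocalRing.residue _) ≠ 0 := by
  obtain ⟨c, m, hc, hm⟩ := exists_coeff_subst_shear_ne_zero hf
  let d : Fin (n + 1) → k := fun i => if i = 0 then (c 0)⁻¹ else - (c i * (c 0)⁻¹)
  have hd0 : d 0 = (c 0)⁻¹ := if_pos rfl
  have hd : ∀ i, i ≠ 0 → d i = - (c i * (c 0)⁻¹) := fun i hi => if_neg hi
  let s := substEquiv (hasSubst_shear c) (hasSubst_shear d)
    (subst_shear_shear (by rw [hd0, inv_mul_cancel₀ hc]) fun i hi => by
      rw [hd i hi, hd0, neg_add_cancel])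
    (subst_shear_shear (by rw [hd0, mul_inv_cancel₀ hc]) fun i hi => by
      rw [hd i hi, neg_mul, inv_mul_cancel_right₀ hc, add_neg_cancel])
  refine ⟨s.trans (finSuccEquiv k n).toRingEquiv, fun h => hm ?_⟩
  have h' := congrArg (PowerSeries.coeff m) h
  rw [PowerSeries.coeff_map, map_zero, IsLocalRing.residue_eq_zero_iff,
    IsLocalRing.mem_maximalIdeal, mem_nonunits_iff, isUnit_iff_constantCoeff, isUnit_iff_ne_zero,
    not_not, ← coeff_zero_eq_constantCoeff_apply] at h'
  have h2 : coeff 0 (PowerSeries.coeff m (finSuccEquiv k n (s f))) = 0 := h'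
  rw [coeff_coeff_finSuccEquiv, substEquiv_apply] at h2
  rwa [Finsupp.cons_zero_eq_single_zero] at h2

instance {σ R : Type*} [CommRing R] [IsDomain R] : IsDomain (MvPowerSeries σ R) :=
  NoZeroDivisors.to_isDomain _

theorem uniqueFactorizationMonoid_fin (k : Type*) [Field k] [Infinite k] (n : ℕ) :
    UniqueFactorizationMonoid (MvPowerSeries (Fin n) k) := by
  induction n with
  | zero =>
    exact ((isEmptyEquiv (Fin 0) k).symm : k ≃* _).uniqueFactorizationMonoid inferInstance
  | succ n ih =>
    rw [UniqueFactorizationMonoid.iff_exists_prime_mem_of_isPrime]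
    intro P hP hPprime
    obtain ⟨f, hfP, hf⟩ := Submodule.exists_mem_ne_zero_of_ne_bot hP
    obtain ⟨e, he⟩ := exists_ringEquiv_map_residue_ne_zero hf
    obtain ⟨p, hp, hpp⟩ := PowerSeries.exists_prime_mem_of_map_residue_ne_zero
      (P.comap (e.symm : _ →+* MvPowerSeries (Fin (n + 1)) k)) (f := e f)
      (by rw [Ideal.mem_comap]; simpa using hfP) he
    exact ⟨e.symm p, hp, (MulEquiv.prime_iff e.symm).2 hpp⟩

end MvPowerSeries

/-! ### Countably many variables as an inverse limit -/

namespace MvPowerSeries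

/-- Invertibility depends only on the constant coefficient, which killing variables preserves. -/
theorem isUnit_killCompl_iff {σ τ R : Type*} [CommRing R] (e : σ ↪ τ) (f : MvPowerSeries τ R) :
    IsUnit (killCompl e f) ↔ IsUnit f := by
  rw [isUnit_iff_constantCoeff, isUnit_iff_constantCoeff, ← coeff_zero_eq_constantCoeff_apply,
    ← coeff_zero_eq_constantCoeff_apply, coeff_killCompl, Finsupp.embDomain_zero]

instance {σ τ R : Type*} [CommRing R] (e : σ ↪ τ) :
    IsLocalHom (killCompl (R := R) e).toRingHom :=
  ⟨fun f hf => (isUnit_killCompl_iff e f).1 hf⟩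

section Nat

variable {R : Type*} [CommRing R]

theorem killCompl_castSucc_killCompl_val (n : ℕ) (f : MvPowerSeries ℕ R) :
    killCompl Fin.castSuccEmb (killCompl (Fin.valEmbedding (n := n + 1)) f) =
      killCompl Fin.valEmbedding f := by
  ext d
  simp only [coeff_killCompl]
  rw [← Finsupp.embDomain_trans_apply]
  rfl

theorem embDomain_castSucc_comapDomain_val {n : ℕ} {d : ℕ →₀ ℕ} (hd : ∀ i ∈ d.support, i < n) :
    (d.comapDomain _ (Fin.val_injective (n := n)).injOn).embDomain Fin.castSuccEmb =
      d.comapDomain _ (Fin.val_injective (n := n + 1)).injOn := by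
  ext i
  induction i using Fin.lastCases with
  | last =>
    rw [Finsupp.embDomain_of_notMem_range _ _ _ (by
      rintro ⟨j, hj⟩
      exact (Fin.castSucc_lt_last j).ne hj), Finsupp.comapDomain_apply, Fin.val_last]
    by_contra h
    exact lt_irrefl n (hd n (Finsupp.mem_support_iff.2 (Ne.symm h)))
  | cast j => exact Finsupp.embDomain_apply_self Fin.castSuccEmb _ j

/-- A compatible sequence of power series in more and more variables comes from a power series in
infinitely many variables. -/
theorem exists_killCompl_eq {N : ℕ} (a : ∀ k, MvPowerSeries (Fin (N + k)) R)
    (ha : ∀ k, killCompl Fin.castSuccEmb (a (k + 1)) = a k) :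
    ∃ x : MvPowerSeries ℕ R, ∀ k, killCompl Fin.valEmbedding x = a k := by
  let c : ℕ → (ℕ →₀ ℕ) → R := fun k d =>
    coeff (d.comapDomain _ (Fin.val_injective (n := N + k)).injOn) (a k)
  have hc : ∀ d : ℕ →₀ ℕ, ∀ k l, k ≤ l → (∀ i ∈ d.support, i < N + k) → c l d = c k d := by
    intro d k l hkl hd
    induction l, hkl using Nat.le_induction with
    | base => rfl
    | succ l hl ih =>
      rw [← ih]
      simp only [c]
      rw [← ha l, coeff_killCompl, embDomain_castSucc_comapDomain_val fun i hi =>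
        (hd i hi).trans_le (Nat.add_le_add_left hl N)]
      rfl
  -- A stage at which all variables of `d` are present; from there on its coefficient no longer
  -- changes.
  let B : (ℕ →₀ ℕ) → ℕ := fun d => d.support.sup id + 1
  have hB : ∀ d : ℕ →₀ ℕ, ∀ i ∈ d.support, i < N + B d := fun d i hi => by
    have : i ≤ d.support.sup id := Finset.le_sup (f := id) hi
    simp only [B]
    omega
  let x : MvPowerSeries ℕ R := fun d => c (B d) d
  have hx : ∀ d, coeff d x = c (B d) d := fun _ => rfl
  refine ⟨x, fun k => MvPowerSeries.ext fun e => ?_⟩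
  set d := e.embDomain Fin.valEmbedding with hd
  have hdk : ∀ i ∈ d.support, i < N + k := fun i hi => by
    rw [hd, Finsupp.support_embDomain, Finset.mem_map] at hi
    obtain ⟨j, -, rfl⟩ := hi
    exact j.2
  have hde : d.comapDomain _ (Fin.val_injective (n := N + k)).injOn = e :=
    Finsupp.ext fun i => Finsupp.embDomain_apply_self Fin.valEmbedding e i
  rw [coeff_killCompl, ← hd, hx, ← hc d _ _ (le_max_left (B d) k) (hB d), hc d _ _ (le_max_right (B d) k) hdk]
  simp only [c]
  rw [hde]

theorem eq_zero_of_killCompl_eq_zero {N : ℕ} {x : MvPowerSeries ℕ R}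
    (hx : ∀ k, killCompl (Fin.valEmbedding (n := N + k)) x = 0) : x = 0 := by
  ext d
  obtain ⟨e, he⟩ : d ∈ Set.range
      (Finsupp.embDomain (M := ℕ) (Fin.valEmbedding (n := N + (d.support.sup id + 1)))) := by
    rw [Finsupp.mem_range_embDomain_iff]
    intro i hi
    have : i ≤ d.support.sup id := Finset.le_sup (f := id) hi
    exact ⟨⟨i, by omega⟩, rfl⟩
  rw [← he, ← coeff_killCompl, hx, map_zero, map_zero]

end Nat

/-- The ring of power series in countably many variables over an infinite field is a unique
factorization domain. -/
theorem uniqueFactorizationMonoid_nat (k : Type*) [Field k] [Infinite k] :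
    UniqueFactorizationMonoid (MvPowerSeries ℕ k) := by
  have := uniqueFactorizationMonoid_fin k
  exact uniqueFactorizationMonoid_of_inverseLimit
    (fun n => (killCompl (R := k) (Fin.castSuccEmb (n := n))).toRingHom)
    (fun n => (killCompl (R := k) (Fin.valEmbedding (n := n))).toRingHom)
    (fun n f => ⟨rename _ f, killCompl_rename_app f⟩)
    (fun n f => killCompl_castSucc_killCompl_val n f)
    (fun N x hx => eq_zero_of_killCompl_eq_zero hx)
    (fun N a ha => exists_killCompl_eq a ha)

end MvPowerSeries

/-! ### Arithmetical functions as power series -/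

namespace BinomialConvolutionRing

/-- The exponent vector of a positive integer. -/
noncomputable def exponents : ℕ+ ≃ (Nat.Primes →₀ ℕ) :=
  PNat.factorMultisetEquiv.trans Multiset.toFinsupp.toEquiv

theorem exponents_mul (a b : ℕ+) : exponents (a * b) = exponents a + exponents b := by
  change Multiset.toFinsupp (PNat.factorMultiset (a * b)) = _
  rw [PNat.factorMultiset_mul]
  exact map_add Multiset.toFinsupp _ _

/-- The power series, with one variable for each prime, whose coefficient at the exponent vector
of `n` is `f(n) / ξ(n)`. -/
noncomputable def toMvPowerSeries (f : BinomialConvolutionRing) : MvPowerSeries Nat.Primes ℂ :=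
  fun d => divXi f (exponents.symm d : ℕ)

theorem coeff_exponents_toMvPowerSeries (f : BinomialConvolutionRing) (n : ℕ+) :
    MvPowerSeries.coeff (exponents n) (toMvPowerSeries f) = divXi f n :=
  congrArg (fun m : ℕ+ => divXi f m) (exponents.symm_apply_apply n)

/-- Factorizations `n = a * b` correspond to splittings of the exponent vector, so the Dirichlet
product becomes the Cauchy product. -/
theorem toMvPowerSeries_mul (f g : BinomialConvolutionRing) :
    toMvPowerSeries (f * g) = toMvPowerSeries f * toMvPowerSeries g := by
  classical
  ext d
  obtain ⟨n, rfl⟩ := exponents.surjective d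
  rw [coeff_exponents_toMvPowerSeries, divXi_mul, ArithmeticFunction.mul_apply,
    MvPowerSeries.coeff_mul]
  symm
  refine Finset.sum_bij (fun x _ => ((exponents.symm x.1 : ℕ), (exponents.symm x.2 : ℕ)))
    (fun x hx => ?_) (fun x _ y _ h => ?_) (fun x hx => ?_) (fun x _ => rfl)
  · rw [Finset.HasAntidiagonal.mem_antidiagonal] at hx
    rw [Nat.mem_divisorsAntidiagonal]
    refine ⟨?_, n.ne_zero⟩
    rw [← PNat.mul_coe]
    congr 1
    apply exponents.injective
    rw [exponents_mul, Equiv.apply_symm_apply, Equiv.apply_symm_apply, hx]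
  · rw [Prod.mk.injEq, PNat.coe_inj, PNat.coe_inj, Equiv.apply_eq_iff_eq,
      Equiv.apply_eq_iff_eq] at h
    exact Prod.ext h.1 h.2
  · obtain ⟨hx, h0⟩ := Nat.mem_divisorsAntidiagonal.1 hx
    rw [← hx] at h0
    let a : ℕ+ := ⟨x.1, Nat.pos_of_ne_zero (left_ne_zero_of_mul h0)⟩
    let b : ℕ+ := ⟨x.2, Nat.pos_of_ne_zero (right_ne_zero_of_mul h0)⟩
    have hab : a * b = n := PNat.coe_injective hx
    refine ⟨(exponents a, exponents b), ?_, ?_⟩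
    · rw [Finset.HasAntidiagonal.mem_antidiagonal, ← exponents_mul, hab]
    · rw [Equiv.symm_apply_apply, Equiv.symm_apply_apply]
      rfl

theorem toMvPowerSeries_bijective : Function.Bijective toMvPowerSeries := by
  refine ⟨fun f g h => divXi_injective (ArithmeticFunction.ext fun n => ?_), fun F => ?_⟩
  · rcases Nat.eq_zero_or_pos n with rfl | hn
    · rw [ArithmeticFunction.map_zero, ArithmeticFunction.map_zero]
    · exact (coeff_exponents_toMvPowerSeries f ⟨n, hn⟩).symm.trans
        (h ▸ coeff_exponents_toMvPowerSeries g ⟨n, hn⟩)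
  · let f : BinomialConvolutionRing := (⟨fun n => if hn : 0 < n then
      MvPowerSeries.coeff (exponents ⟨n, hn⟩) F * xi n else 0, by simp⟩ : ArithmeticFunction ℂ)
    refine ⟨f, MvPowerSeries.ext fun d => ?_⟩
    obtain ⟨n, rfl⟩ := exponents.surjective d
    refine (coeff_exponents_toMvPowerSeries f n).trans ?_
    change (if hn : 0 < (n : ℕ) then MvPowerSeries.coeff (exponents ⟨n, hn⟩) F * xi n else 0) /
      (xi n : ℂ) = _
    rw [dif_pos n.pos, mul_div_cancel_right₀ _ (xi_ne_zero n)]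
    rfl

/-- The binomial convolution ring is isomorphic to the ring of complex power series in countably
many variables. -/
noncomputable def mulEquivMvPowerSeries : BinomialConvolutionRing ≃* MvPowerSeries ℕ ℂ :=
  (MulEquiv.ofBijective (⟨toMvPowerSeries, toMvPowerSeries_mul⟩ :
      BinomialConvolutionRing →ₙ* MvPowerSeries Nat.Primes ℂ) toMvPowerSeries_bijective).trans
    (MvPowerSeries.renameEquiv ℂ (nonempty_equiv_of_countable (α := Nat.Primes) (β := ℕ)).some).toMulEquiv

end BinomialConvolutionRing

theorem corollary2p1 :
    IsDomain BinomialConvolutionRing ∧ UniqueFactorizationMonoid BinomialConvolutionRing := by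
  let e := BinomialConvolutionRing.mulEquivMvPowerSeries
  have : IsDomain BinomialConvolutionRing := e.isDomain (MvPowerSeries ℕ ℂ)
  exact ⟨this, e.symm.uniqueFactorizationMonoid (MvPowerSeries.uniqueFactorizationMonoid_nat ℂ)⟩
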